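/- **Theorem.** Let $L$ be a Lie ring over $\mathbb Z$, with universal enveloping ring $U(L)$, natural map $\iota\colon L\to U(L)$ and augmentation ideal $\varpi(L)$ (the two-sided ideal generated by $\iota(L)$). Put $\gamma_1(L)=L$, $\gamma_{n+1}(L)=[L,\gamma_n(L)]$, and $\delta_n(L)=L\cap\varpi^n(L)=\iota^{-1}(\varpi^n(L))$. Let $\mathbf L\to L$ be a free simplicial resolution, that is, an augmented simplicial Lie ring $(L_m)_{m\ge0}$ with $L_{-1}=L$ such that (a) for every $m\ge-1$, every tuple $(a_0,\dots,a_{m+1})\in L_m^{m+2}$ with $d_ia_j=d_{j-1}a_i$ for all $i<j$ has the form $(d_0a,\dots,d_{m+1}a)$ with $a\in L_{m+1}$, and (b) every $L_m$, $m\ge0$, is a free Lie ring on a set $X_m$ with $s_iX_m\subseteq X_{m+1}$ for all $i$. Let $E^r_{p,q}$, with $E^1_{p,q}=\pi_q\bigl(\gamma_p(\mathbf L)/\gamma_{p+1}(\mathbf L)\bigr)$ and differentials $d^r$ of bidegree $(r,-1)$, be the spectral sequence of the homotopy exact couple of the short exact sequences $$0\to\gamma_p(\mathbf L)/\gamma_{p+1}(\mathbf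 L)\to\mathbf L/\gamma_{p+1}(\mathbf L)\to\mathbf L/\gamma_p(\mathbf L)\to0,$$ and let $\overline E^r_{p,q}$, with $\overline E^1_{p,q}=\pi_q\bigl(\varpi^p(\mathbf L)/\varpi^{p+1}(\mathbf L)\bigr)$, be that of $$0\to\varpi^p(\mathbf L)/\varpi^{p+1}(\mathbf L)\to U(\mathbf L)/\varpi^{p+1}(\mathbf L)\to U(\mathbf L)/\varpi^p(\mathbf L)\to0.$$ The map $\iota\colon\mathbf L\to U(\mathbf L)$ induces a morphism of spectral sequences, in particular maps $\iota^\infty_{p,q}\colon E^\infty_{p,q}\to\overline E^\infty_{p,q}$. Then for every $n\ge1$ there is an isomorphism $\varphi\colon\gamma_n(L)/\gamma_{n+1}(L)\to E^\infty_{n,0}$ which, for every $x\in\gamma_n(L_0)$, sends the class of the image of $x$ in $L$ to the class of $x$ in $E^\infty_{n,0}$, and under this (unique) identification $$\frac{\gamma_n(L)\cap\delta_{n+1}(L)}{\gamma_{n+1}(L)}=\ker\bigl[\iota^\infty_{n,0}\colon E^\infty_{n,0}\to\overline E^\infty_{n,0}\bigr].$$ -/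

import Mathlib

open CategoryTheory Opposite Simplicial

universe u v w

noncomputable section

namespace LieDimension

/-! ### Subquotients of abelian groups -/

/-- The subquotient `Z / B` of an abelian group, used when `B ≤ Z`. -/
abbrev SubQuotient {M : Type*} [AddCommGroup M] (Z B : AddSubgroup M) :=
  Z ⧸ B.addSubgroupOf Z

namespace SubQuotient

variable {M : Type*} [AddCommGroup M] {N : Type*} [AddCommGroup N]

/-- The class in `Z / B` of an element of `Z`. -/
def mk (Z B : AddSubgroup M) : Z →+ SubQuotient Z B := QuotientAddGroup.mk' _

/-- The map of subquotients induced by a homomorphism. -/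
def map {Z B : AddSubgroup M} {Z' B' : AddSubgroup N} (f : M →+ N) (hZ : Z ≤ Z'.comap f)
    (hB : B ≤ B'.comap f) : SubQuotient Z B →+ SubQuotient Z' B' :=
  QuotientAddGroup.map _ _ ((f.comp Z.subtype).codRestrict Z' fun x ↦ hZ x.2) fun _ hx ↦ hB hx

lemma mk_surjective (Z B : AddSubgroup M) : Function.Surjective (mk Z B) :=
  QuotientAddGroup.mk'_surjective _

lemma mk_eq_zero_iff {Z B : AddSubgroup M} (x : Z) : mk Z B x = 0 ↔ (x : M) ∈ B :=
  QuotientAddGroup.eq_zero_iff x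

@[simp]
lemma map_mk {Z B : AddSubgroup M} {Z' B' : AddSubgroup N} (f : M →+ N) (hZ : Z ≤ Z'.comap f)
    (hB : B ≤ B'.comap f) (x : Z) : map f hZ hB (mk Z B x) = mk Z' B' ⟨f x, hZ x.2⟩ :=
  rfl

/-- The subgroup `W / B` of `Z / B` given by a subgroup `W` with `B ≤ W ≤ Z`. -/
def sub (W Z B : AddSubgroup M) : AddSubgroup (SubQuotient Z B) :=
  (W.addSubgroupOf Z).map (mk Z B)

end SubQuotient

/-! ### Exact couples and their spectral sequences -/

/-- A bigraded exact couple of abelian groups `D → D → E → D`, concentrated in degrees `q ≥ 0`.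
The maps `i`, of bidegree `(-1, 0)`, are given together with all their composites
`D p q → D p' q`, `p' ≤ p` (so `i` is the structure map of a tower); `k` has bidegree `(1, 0)` and
`j` has bidegree `(0, -1)`. -/
structure ExactCouple where
  D : ℤ → ℕ → AddCommGrpCat.{u}
  E : ℤ → ℕ → AddCommGrpCat.{u}
  i : ∀ {p p' : ℤ} (_ : p' ≤ p) (q : ℕ), D p q →+ D p' q
  i_refl : ∀ (p : ℤ) (q : ℕ) (x : D p q), i (le_refl p) q x = x
  i_trans : ∀ {p p' p'' : ℤ} (h : p' ≤ p) (h' : p'' ≤ p') (q : ℕ) (x : D p q),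
    i h' q (i h q x) = i (h'.trans h) q x
  k : ∀ (p : ℤ) (q : ℕ), E p q →+ D (p + 1) q
  j : ∀ (p : ℤ) (q : ℕ), D p (q + 1) →+ E p q
  exact_jk : ∀ (p : ℤ) (q : ℕ), Function.Exact (j p q) (k p q)
  exact_ki : ∀ (p : ℤ) (q : ℕ), Function.Exact (k p q) (i (p' := p) (by lia : p ≤ p + 1) q)
  exact_ij : ∀ (p : ℤ) (q : ℕ),
    Function.Exact (i (p' := p) (by lia : p ≤ p + 1) (q + 1)) (j p q)
  i_surjective : ∀ (p : ℤ), Function.Surjective (i (p' := p) (by lia : p ≤ p + 1) 0)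

namespace ExactCouple

variable (C : ExactCouple.{u})

/-- The `r`-cycles `Z^r = k⁻¹(im i^{r-1}) ⊆ E^1`, where `r = s + 1`. -/
def cycles (s : ℕ) (p : ℤ) (q : ℕ) : AddSubgroup (C.E p q) :=
  (AddMonoidHom.range (C.i (by lia : p + 1 ≤ p + 1 + s) q)).comap (C.k p q)

/-- The `r`-boundaries `B^r = j(ker i^{r-1}) ⊆ E^1`, where `r = s + 1`. -/
def boundaries (s : ℕ) (p : ℤ) (q : ℕ) : AddSubgroup (C.E p q) :=
  (AddMonoidHom.ker (C.i (by lia : p - s ≤ p) (q + 1))).map (C.j p q)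

/-- The term `E^r = Z^r / B^r` of the spectral sequence of the exact couple, where `r = s + 1`. -/
abbrev Page (s : ℕ) (p : ℤ) (q : ℕ) : Type u :=
  SubQuotient (C.cycles s p q) (C.boundaries s p q)

/-- `Z^∞`, the intersection of all `Z^r`. -/
def cyclesInfty (p : ℤ) (q : ℕ) : AddSubgroup (C.E p q) := ⨅ s : ℕ, C.cycles s p q

/-- `B^∞`, the union of the increasing chain of all `B^r`. -/
def boundariesInfty (p : ℤ) (q : ℕ) : AddSubgroup (C.E p q) := ⨆ s : ℕ, C.boundaries s p q

/-- The limit term `E^∞ = Z^∞ / B^∞` of the spectral sequence of the exact couple. -/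
abbrev EInfty (p : ℤ) (q : ℕ) : Type u :=
  SubQuotient (C.cyclesInfty p q) (C.boundariesInfty p q)

lemma i_surjective' {p p' : ℤ} (h : p' ≤ p) : Function.Surjective (C.i h 0) := by
  obtain ⟨m, rfl⟩ := Int.le.dest h
  induction m with
  | zero =>
    intro x
    have e : p' + (0 : ℕ) = p' := by simp
    have h' : p' + (0 : ℕ) ≤ p' := e.le
    exact ⟨C.i h' 0 x, by rw [C.i_trans, C.i_refl]⟩
  | succ m ih =>
    intro x
    obtain ⟨y, rfl⟩ := ih (by lia) x
    obtain ⟨z, rfl⟩ := C.i_surjective _ y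
    have h' : p' + (m : ℤ) + 1 ≤ p' + ((m + 1 : ℕ) : ℤ) := by push_cast; lia
    have h'' : p' + ((m + 1 : ℕ) : ℤ) ≤ p' + (m : ℤ) + 1 := by push_cast; lia
    exact ⟨C.i h'' 0 z, by rw [C.i_trans, C.i_trans]⟩

/-- On the row `q = 0` everything is a cycle, since all differentials from it land in `q = -1`. -/
lemma mem_cyclesInfty_zero (p : ℤ) (x : C.E p 0) : x ∈ C.cyclesInfty p 0 := by
  simp only [cyclesInfty, AddSubgroup.mem_iInf, cycles, AddSubgroup.mem_comap, AddMonoidHom.mem_range]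
  intro s
  exact C.i_surjective' _ _

/-- The edge homomorphism `E^1_{p,0} → E^∞_{p,0}`. -/
def edge (p : ℤ) : C.E p 0 →+ C.EInfty p 0 :=
  (SubQuotient.mk _ _).comp ((AddMonoidHom.id _).codRestrict _ (C.mem_cyclesInfty_zero p))

/-! The differentials `d^r` of bidegree `(r, -1)`, and the fact that `E^{r+1}` is the homology of
`(E^r, d^r)`. -/

lemma exists_lift {s : ℕ} {p : ℤ} {q : ℕ} (x : C.cycles s p (q + 1)) :
    ∃ w : C.D (p + 1 + s) (q + 1), C.i (by lia : p + 1 ≤ p + 1 + s) (q + 1) w = C.k p (q + 1) x :=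
  x.2

lemma j_mem_boundaries {s : ℕ} {p p' : ℤ} {q : ℕ} (h : p' - s ≤ p) (h' : p ≤ p')
    (w : C.D p' (q + 1)) (hw : C.i h' (q + 1) w = 0) :
    C.j p' q w ∈ C.boundaries s p' q :=
  ⟨w, by rw [SetLike.mem_coe, AddMonoidHom.mem_ker, ← C.i_trans h' h, hw, map_zero], rfl⟩

lemma j_mem_cycles (s : ℕ) (p : ℤ) (q : ℕ) (w : C.D p (q + 1)) :
    C.j p q w ∈ C.cycles s p q := by
  rw [cycles, AddSubgroup.mem_comap, (C.exact_jk p q).apply_apply_eq_zero]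
  exact AddSubgroup.zero_mem _

lemma boundaries_le_cycles (s t : ℕ) (p : ℤ) (q : ℕ) :
    C.boundaries s p q ≤ C.cycles t p q := by
  rintro _ ⟨w, -, rfl⟩
  exact C.j_mem_cycles _ _ _ _

/-- The class of `j w` in `E^r`. -/
def jPage (s : ℕ) (p : ℤ) (q : ℕ) : C.D p (q + 1) →+ C.Page s p q :=
  (SubQuotient.mk _ _).comp ((C.j p q).codRestrict _ (C.j_mem_cycles s p q))

lemma jPage_eq_zero_iff {s : ℕ} {p : ℤ} {q : ℕ} (w : C.D p (q + 1)) :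
    C.jPage s p q w = 0 ↔ C.j p q w ∈ C.boundaries s p q := 
  SubQuotient.mk_eq_zero_iff _

lemma jPage_congr {s : ℕ} {p : ℤ} {q : ℕ} {w w' : C.D (p + 1 + s) (q + 1)}
    (h : C.i (by lia : p + 1 ≤ p + 1 + s) (q + 1) w = C.i (by lia) (q + 1) w') :
    C.jPage s (p + 1 + s) q w = C.jPage s (p + 1 + s) q w' := by
  rw [← sub_eq_zero, ← map_sub, jPage_eq_zero_iff]
  exact C.j_mem_boundaries (p := p + 1) (by lia) (by lia) _ (by rw [map_sub, h, sub_self])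

/-- The differential `d^r` on `r`-cycles: `x ↦ [j w]` for any `w` with `i^{r-1} w = k x`. -/
def dCycles (s : ℕ) (p : ℤ) (q : ℕ) :
    C.cycles s p (q + 1) →+ C.Page s (p + 1 + s) q where
  toFun x := C.jPage s _ q (C.exists_lift x).choose
  map_zero' := by
    rw [← map_zero (C.jPage s (p + 1 + s) q)]
    apply C.jPage_congr
    rw [(C.exists_lift 0).choose_spec, map_zero, AddSubgroup.coe_zero, map_zero]
  map_add' x y := by
    rw [← map_add]
    apply C.jPage_congr
    rw [(C.exists_lift (x + y)).choose_spec, map_add, (C.exists_lift x).choose_spec,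
      (C.exists_lift y).choose_spec, AddSubgroup.coe_add, map_add]

lemma dCycles_eq {s : ℕ} {p : ℤ} {q : ℕ} (x : C.cycles s p (q + 1)) (w : C.D (p + 1 + s) (q + 1))
    (hw : C.i (by lia : p + 1 ≤ p + 1 + s) (q + 1) w = C.k p (q + 1) x) :
    C.dCycles s p q x = C.jPage s _ q w :=
  C.jPage_congr ((C.exists_lift x).choose_spec.trans hw.symm)

/-- The differential `d^r : E^r_{p,q+1} → E^r_{p+r,q}`, where `r = s + 1`. -/
def d (s : ℕ) (p : ℤ) (q : ℕ) : C.Page s p (q + 1) →+ C.Page s (p + 1 + s) q :=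
  QuotientAddGroup.lift _ (C.dCycles s p q) (by
    rintro ⟨_, _⟩ ⟨u, -, rfl⟩
    rw [AddMonoidHom.mem_ker, C.dCycles_eq _ 0, map_zero]
    rw [map_zero]
    exact ((C.exact_jk p (q + 1)).apply_apply_eq_zero u).symm)

/-- The kernel of `d^r` is the image of `Z^{r+1}` in `E^r`. -/
theorem d_mk_eq_zero_iff {s : ℕ} {p : ℤ} {q : ℕ} (x : C.cycles s p (q + 1)) :
    C.d s p q (SubQuotient.mk _ _ x) = 0 ↔ (x : C.E p (q + 1)) ∈ C.cycles (s + 1) p (q + 1) := by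
  change C.dCycles s p q x = 0 ↔ _
  obtain ⟨w, hw⟩ := C.exists_lift x
  rw [C.dCycles_eq x w hw, jPage_eq_zero_iff, cycles, AddSubgroup.mem_comap]
  constructor
  · rintro ⟨u, hu, hju⟩
    obtain ⟨z, hz⟩ := (C.exact_ij _ _ (w - u)).1 (by rw [map_sub, hju, sub_self])
    refine ⟨C.i (by push_cast; lia) _ z, ?_⟩
    rw [C.i_trans, ← C.i_trans (by lia : p + 1 + s ≤ p + 1 + s + 1) (by lia), hz, map_sub, hw,
      sub_eq_self, ← C.i_trans (by lia : p + 1 + s - s ≤ p + 1 + s) (by lia),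
      AddMonoidHom.mem_ker.1 hu, map_zero]
  · rintro ⟨z, hz⟩
    have e : C.i (by lia : p + 1 ≤ p + 1 + s) (q + 1)
        (w - C.i (by push_cast; lia : p + 1 + s ≤ p + 1 + ((s + 1 : ℕ) : ℤ)) _ z) = 0 := by
      rw [map_sub, C.i_trans, hw, hz, sub_self]
    have := C.j_mem_boundaries (s := s) (by lia) _ _ e
    rwa [map_sub, ← C.i_trans (by push_cast; lia : p + 1 + s + 1 ≤ p + 1 + ((s + 1 : ℕ) : ℤ))
      (by lia : p + 1 + s ≤ p + 1 + s + 1), (C.exact_ij _ _).apply_apply_eq_zero, sub_zero] at this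

/-- The image of `d^r` is the image of `B^{r+1}` in `E^r`. -/
theorem mk_mem_range_d_iff {s : ℕ} {p : ℤ} {q : ℕ} (y : C.cycles s (p + 1 + s) q) :
    SubQuotient.mk _ _ y ∈ AddMonoidHom.range (C.d s p q) ↔
      (y : C.E (p + 1 + s) q) ∈ C.boundaries (s + 1) (p + 1 + s) q := by
  constructor
  · rintro ⟨x, hx⟩
    obtain ⟨x, rfl⟩ := SubQuotient.mk_surjective _ _ x
    change C.dCycles s p q x = _ at hx
    obtain ⟨w, hw⟩ := C.exists_lift x
    rw [C.dCycles_eq x w hw, jPage] at hx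
    rw [AddMonoidHom.comp_apply, eq_comm, ← sub_eq_zero, ← map_sub,
      SubQuotient.mk_eq_zero_iff] at hx
    obtain ⟨u, hu, hju⟩ := hx
    have e : (y : C.E (p + 1 + s) q) = C.j _ _ (u + w) := by
      rw [map_add, hju]; simp
    rw [e]
    apply C.j_mem_boundaries (p := p) (by push_cast; lia) (by lia)
    rw [← C.i_trans (by lia : p + 1 ≤ p + 1 + s) (by lia : p ≤ p + 1), map_add, hw, map_add,
      (C.exact_ki _ _).apply_apply_eq_zero, add_zero, C.i_trans,
      ← C.i_trans (by lia : p + 1 + s - s ≤ p + 1 + s) (by lia), AddMonoidHom.mem_ker.1 hu, map_zero]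
  · rintro ⟨w, hw, hy⟩
    have e : C.i (by lia : p ≤ p + 1) (q + 1) (C.i (by lia : p + 1 ≤ p + 1 + s) (q + 1) w) = 0 := by
      rw [C.i_trans, ← C.i_trans (by lia : p + 1 + s - (s + 1 : ℕ) ≤ p + 1 + s)
        (by push_cast; lia), AddMonoidHom.mem_ker.1 hw, map_zero]
    obtain ⟨x, hx⟩ := (C.exact_ki _ _ _).1 e
    refine ⟨SubQuotient.mk _ _ ⟨x, ⟨w, hx.symm⟩⟩, ?_⟩
    change C.dCycles s p q _ = _
    rw [C.dCycles_eq _ w hx.symm, jPage]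
    exact congrArg _ (Subtype.ext hy)

/-- A morphism of exact couples. -/
structure Hom (C C' : ExactCouple.{u}) where
  onD : ∀ (p : ℤ) (q : ℕ), C.D p q →+ C'.D p q
  onE : ∀ (p : ℤ) (q : ℕ), C.E p q →+ C'.E p q
  comm_i : ∀ {p p' : ℤ} (h : p' ≤ p) (q : ℕ) (x : C.D p q),
    onD p' q (C.i h q x) = C'.i h q (onD p q x)
  comm_j : ∀ (p : ℤ) (q : ℕ) (x : C.D p (q + 1)), onE p q (C.j p q x) = C'.j p q (onD p (q + 1) x)
  comm_k : ∀ (p : ℤ) (q : ℕ) (x : C.E p q), onD (p + 1) q (C.k p q x) = C'.k p q (onE p q x)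

namespace Hom

variable {C} {C' : ExactCouple.{u}} (φ : Hom C C')

lemma cycles_le (s : ℕ) (p : ℤ) (q : ℕ) :
    C.cycles s p q ≤ (C'.cycles s p q).comap (φ.onE p q) := by
  rintro x ⟨w, hw⟩
  exact ⟨φ.onD _ _ w, by rw [← φ.comm_i, hw, φ.comm_k]⟩

lemma boundaries_le (s : ℕ) (p : ℤ) (q : ℕ) :
    C.boundaries s p q ≤ (C'.boundaries s p q).comap (φ.onE p q) := by
  rintro _ ⟨w, hw, rfl⟩
  exact ⟨φ.onD _ _ w, by
    rw [SetLike.mem_coe, AddMonoidHom.mem_ker, ← φ.comm_i, AddMonoidHom.mem_ker.1 hw, map_zero],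
    (φ.comm_j _ _ _).symm⟩

lemma cyclesInfty_le (p : ℤ) (q : ℕ) :
    C.cyclesInfty p q ≤ (C'.cyclesInfty p q).comap (φ.onE p q) := by
  intro x hx
  rw [AddSubgroup.mem_comap, cyclesInfty, AddSubgroup.mem_iInf]
  exact fun s ↦ φ.cycles_le s p q (AddSubgroup.mem_iInf.1 hx s)

lemma boundariesInfty_le (p : ℤ) (q : ℕ) :
    C.boundariesInfty p q ≤ (C'.boundariesInfty p q).comap (φ.onE p q) :=
  iSup_le fun s ↦ (φ.boundaries_le s p q).trans
    (AddSubgroup.comap_mono (le_iSup (fun s ↦ C'.boundaries s p q) s))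

/-- The map induced on the term `E^r`, where `r = s + 1`. -/
def onPage (s : ℕ) (p : ℤ) (q : ℕ) : C.Page s p q →+ C'.Page s p q :=
  SubQuotient.map (φ.onE p q) (φ.cycles_le s p q) (φ.boundaries_le s p q)

/-- The map induced on the term `E^∞`. -/
def onEInfty (p : ℤ) (q : ℕ) : C.EInfty p q →+ C'.EInfty p q :=
  SubQuotient.map (φ.onE p q) (φ.cyclesInfty_le p q) (φ.boundariesInfty_le p q)

end Hom

end ExactCouple

/-! ### The homotopy exact couple of a filtered functor -/

/-- A functor to abelian groups together with a decreasing filtration by subfunctors. -/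
structure FilteredFunctor (A : Type v) [Category.{w} A] where
  G : A ⥤ AddCommGrpCat.{u}
  F : ℤ → ∀ X : A, AddSubgroup (G.obj X)
  anti : ∀ X : A, Antitone (fun p ↦ F p X)
  map_le : ∀ (p : ℤ) {X Y : A} (f : X ⟶ Y), F p X ≤ (F p Y).comap (G.map f).hom

/-- The abelian group `π_q` of a simplicial abelian group: the homology in degree `q` of its
alternating face map complex `(X_n, ∑ (-1)^i d_i)`. -/
abbrev homotopyGroup (X : SimplicialObject AddCommGrpCat.{u}) (q : ℕ) : AddCommGrpCat.{u} :=
  ((AlgebraicTopology.alternatingFaceMapComplex AddCommGrpCat.{u}).obj X).homology q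

/-- The homotopy groups are functorial. -/
abbrev homotopyMap {X Y : SimplicialObject AddCommGrpCat.{u}} (f : X ⟶ Y) (q : ℕ) :
    homotopyGroup X q ⟶ homotopyGroup Y q :=
  HomologicalComplex.homologyMap
    ((AlgebraicTopology.alternatingFaceMapComplex AddCommGrpCat.{u}).map f) q

/-- The projection `X_0 → π_0 X`. -/
def toHomotopyZero (X : SimplicialObject AddCommGrpCat.{u}) : X _⦋0⦌ ⟶ homotopyGroup X 0 :=
  ((AlgebraicTopology.alternatingFaceMapComplex AddCommGrpCat.{u}).obj X).pOpcycles 0 ≫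
    (ChainComplex.isoHomologyι₀ _).inv

/-- A functor `A ⥤ Ab` applied degreewise to a simplicial object of `A`. -/
abbrev levelwise {A : Type v} [Category.{w} A] (X : SimplicialObject A) (G : A ⥤ AddCommGrpCat.{u}) :
    SimplicialObject AddCommGrpCat.{u} :=
  ((SimplicialObject.whiskering A AddCommGrpCat.{u}).obj G).obj X

/-- A natural transformation applied degreewise to a simplicial object. -/
abbrev levelwiseMap {A : Type v} [Category.{w} A] (X : SimplicialObject A)
    {G G' : A ⥤ AddCommGrpCat.{u}} (τ : G ⟶ G') : levelwise X G ⟶ levelwise X G' :=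
  ((SimplicialObject.whiskering A AddCommGrpCat.{u}).map τ).app X

namespace FilteredFunctor

variable {A : Type v} [Category.{w} A] (T : FilteredFunctor.{u} A)

/-- The functor `X ↦ G X / F_p X`. -/
def quo (p : ℤ) : A ⥤ AddCommGrpCat.{u} where
  obj X := AddCommGrpCat.of (T.G.obj X ⧸ T.F p X)
  map f := AddCommGrpCat.ofHom (QuotientAddGroup.map _ _ (T.G.map f).hom (T.map_le p f))
  map_id X := by
    ext x
    simp
  map_comp f g := by
    ext x
    simp

/-- The functor `X ↦ F_p X / F_{p+1} X`. -/
def gr (p : ℤ) : A ⥤ AddCommGrpCat.{u} where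
  obj X := AddCommGrpCat.of (SubQuotient (T.F p X) (T.F (p + 1) X))
  map f := AddCommGrpCat.ofHom
    (SubQuotient.map (T.G.map f).hom (T.map_le p f) (T.map_le (p + 1) f))
  map_id X := by
    ext x
    simp
    rfl
  map_comp f g := by
    ext x
    simp
    rfl

/-- The projection `G / F_p → G / F_{p'}` for `p' ≤ p`. -/
def proj {p p' : ℤ} (h : p' ≤ p) : T.quo p ⟶ T.quo p' where
  app X := AddCommGrpCat.ofHom (QuotientAddGroup.map _ _ (AddMonoidHom.id _) (T.anti X h))
  naturality X Y f := by
    ext x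
    obtain ⟨x, rfl⟩ := QuotientAddGroup.mk_surjective x
    rfl

/-- The inclusion `F_p / F_{p+1} → G / F_{p+1}`. -/
def incl (p : ℤ) : T.gr p ⟶ T.quo (p + 1) where
  app X := AddCommGrpCat.ofHom (QuotientAddGroup.map _ _ (T.F p X).subtype fun _ hx ↦ hx)
  naturality X Y f := by
    ext x
    obtain ⟨x, rfl⟩ := SubQuotient.mk_surjective _ _ x
    rfl

lemma proj_refl (p : ℤ) : T.proj (le_refl p) = 𝟙 _ := by
  ext X x
  obtain ⟨x, rfl⟩ := QuotientAddGroup.mk_surjective x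
  rfl

lemma proj_trans {p p' p'' : ℤ} (h : p' ≤ p) (h' : p'' ≤ p') :
    T.proj h ≫ T.proj h' = T.proj (h'.trans h) := by
  ext X x
  obtain ⟨x, rfl⟩ := QuotientAddGroup.mk_surjective x
  rfl

variable (X : SimplicialObject A)

/-- The sequence of complexes `gr_p X → Γ_{p+1} X → Γ_p X` of a simplicial object. -/
def shortComplex (p : ℤ) : ShortComplex (ChainComplex AddCommGrpCat.{u} ℕ) :=
  ShortComplex.mk
    ((AlgebraicTopology.alternatingFaceMapComplex _).map (levelwiseMap X (T.incl p)))
    ((AlgebraicTopology.alternatingFaceMapComplex _).map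
      (levelwiseMap X (T.proj (by lia : p ≤ p + 1)))) (by
    ext n x
    obtain ⟨x, rfl⟩ := SubQuotient.mk_surjective _ _ x
    exact (QuotientAddGroup.eq_zero_iff _).2 x.2)

lemma shortComplex_shortExact (p : ℤ) : (T.shortComplex X p).ShortExact := by
  apply HomologicalComplex.shortExact_of_degreewise_shortExact
  intro n
  refine ShortComplex.ShortExact.mk' ?_ ?_ ?_
  · rw [ShortComplex.ab_exact_iff]
    intro x hx
    obtain ⟨x, rfl⟩ := QuotientAddGroup.mk_surjective x
    exact ⟨SubQuotient.mk _ _ ⟨x, (QuotientAddGroup.eq_zero_iff _).1 hx⟩, rfl⟩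
  · rw [AddCommGrpCat.mono_iff_injective]
    refine (injective_iff_map_eq_zero
      ((AddCommGrpCat.Hom.hom ((T.incl p).app (X.obj (op ⦋n⦌)))))).2 ?_
    intro x hx
    obtain ⟨x, rfl⟩ := SubQuotient.mk_surjective _ _ x
    exact (SubQuotient.mk_eq_zero_iff x).2 ((QuotientAddGroup.eq_zero_iff _).1 hx)
  · rw [AddCommGrpCat.epi_iff_surjective]
    intro x
    obtain ⟨x, rfl⟩ := QuotientAddGroup.mk_surjective x
    exact ⟨QuotientAddGroup.mk x, rfl⟩

/-- The homotopy exact couple of a simplicial object `X` with respect to a filtered functor: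
`D_{p,q} = π_q(G X / F_p X)` and `E_{p,q} = π_q(F_p X / F_{p+1} X)`, with the maps of the long exact
homotopy sequences of `0 → F_p X / F_{p+1} X → G X / F_{p+1} X → G X / F_p X → 0`. -/
def exactCouple : ExactCouple.{u} where
  D p q := homotopyGroup (levelwise X (T.quo p)) q
  E p q := homotopyGroup (levelwise X (T.gr p)) q
  i h q := (homotopyMap (levelwiseMap X (T.proj h)) q).hom
  i_refl p q x := by
    rw [T.proj_refl]
    simp [homotopyMap, levelwiseMap]
  i_trans h h' q x := by
    rw [← T.proj_trans h h']
    simp [homotopyMap, levelwiseMap, HomologicalComplex.homologyMap_comp]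
  k p q := (homotopyMap (levelwiseMap X (T.incl p)) q).hom
  j p q := ((T.shortComplex_shortExact X p).δ (q + 1) q rfl).hom
  exact_jk p q := (ShortComplex.ab_exact_iff_function_exact _).1
    ((T.shortComplex_shortExact X p).homology_exact₁ (q + 1) q rfl)
  exact_ki p q := (ShortComplex.ab_exact_iff_function_exact _).1
    ((T.shortComplex_shortExact X p).homology_exact₂ q)
  exact_ij p q := (ShortComplex.ab_exact_iff_function_exact _).1
    ((T.shortComplex_shortExact X p).homology_exact₃ (q + 1) q rfl)
  i_surjective p := by
    have h := T.shortComplex_shortExact X p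
    have := h.epi_g
    exact (AddCommGrpCat.epi_iff_surjective _).1
      (HomologicalComplex.epi_homologyMap_of_epi_of_not_rel (T.shortComplex X p).g 0 (by simp))

/-- A natural transformation of filtered functors. -/
structure Hom (T T' : FilteredFunctor.{u} A) where
  τ : T.G ⟶ T'.G
  map_le : ∀ (p : ℤ) (X : A), T.F p X ≤ (T'.F p X).comap (τ.app X).hom

namespace Hom

variable {T} {T' : FilteredFunctor.{u} A} (φ : Hom T T')

lemma τ_map {X Y : A} (f : X ⟶ Y) (x : T.G.obj X) :
    (φ.τ.app Y).hom ((T.G.map f).hom x) = (T'.G.map f).hom ((φ.τ.app X).hom x) :=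
  ConcreteCategory.congr_hom (φ.τ.naturality f) x

/-- The induced transformation `G / F_p → G' / F'_p`. -/
def onQuo (p : ℤ) : T.quo p ⟶ T'.quo p where
  app X := AddCommGrpCat.ofHom (QuotientAddGroup.map _ _ (φ.τ.app X).hom (φ.map_le p X))
  naturality X Y f := by
    ext x
    obtain ⟨x, rfl⟩ := QuotientAddGroup.mk_surjective x
    exact congrArg (QuotientAddGroup.mk (s := T'.F p Y)) (φ.τ_map f x)

/-- The induced transformation `F_p / F_{p+1} → F'_p / F'_{p+1}`. -/
def onGr (p : ℤ) : T.gr p ⟶ T'.gr p where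
  app X := AddCommGrpCat.ofHom
    (SubQuotient.map (φ.τ.app X).hom (φ.map_le p X) (φ.map_le (p + 1) X))
  naturality X Y f := by
    ext x
    obtain ⟨x, hx⟩ := x
    exact congrArg (SubQuotient.mk (T'.F p Y) (T'.F (p + 1) Y)) (Subtype.ext (φ.τ_map f x))

lemma onQuo_proj {p p' : ℤ} (h : p' ≤ p) : T.proj h ≫ φ.onQuo p' = φ.onQuo p ≫ T'.proj h := by
  ext X x
  obtain ⟨x, rfl⟩ := QuotientAddGroup.mk_surjective x
  rfl

lemma onGr_incl (p : ℤ) : T.incl p ≫ φ.onQuo (p + 1) = φ.onGr p ≫ T'.incl p := by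
  ext X x
  obtain ⟨x, rfl⟩ := SubQuotient.mk_surjective _ _ x
  rfl

/-- The induced morphism of the short exact sequences of complexes. -/
def onShortComplex (X : SimplicialObject A) (p : ℤ) : T.shortComplex X p ⟶ T'.shortComplex X p where
  τ₁ := (AlgebraicTopology.alternatingFaceMapComplex _).map (levelwiseMap X (φ.onGr p))
  τ₂ := (AlgebraicTopology.alternatingFaceMapComplex _).map (levelwiseMap X (φ.onQuo (p + 1)))
  τ₃ := (AlgebraicTopology.alternatingFaceMapComplex _).map (levelwiseMap X (φ.onQuo p))
  comm₁₂ := by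
    dsimp only [shortComplex]
    rw [← Functor.map_comp, ← Functor.map_comp, levelwiseMap, levelwiseMap, levelwiseMap,
      ← NatTrans.comp_app, ← NatTrans.comp_app, ← Functor.map_comp, ← Functor.map_comp, onGr_incl]
  comm₂₃ := by
    dsimp only [shortComplex]
    rw [← Functor.map_comp, ← Functor.map_comp, levelwiseMap, levelwiseMap, levelwiseMap,
      ← NatTrans.comp_app, ← NatTrans.comp_app, ← Functor.map_comp, ← Functor.map_comp, onQuo_proj]

/-- The induced morphism of homotopy exact couples. -/
def onExactCouple (X : SimplicialObject A) : (T.exactCouple X).Hom (T'.exactCouple X) where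
  onD p q := (homotopyMap (levelwiseMap X (φ.onQuo p)) q).hom
  onE p q := (homotopyMap (levelwiseMap X (φ.onGr p)) q).hom
  comm_i h q x := by
    refine ConcreteCategory.congr_hom (?_ : homotopyMap _ q ≫ homotopyMap _ q =
      homotopyMap _ q ≫ homotopyMap _ q) x
    rw [← HomologicalComplex.homologyMap_comp, ← HomologicalComplex.homologyMap_comp,
      ← Functor.map_comp, ← Functor.map_comp, levelwiseMap, levelwiseMap, levelwiseMap,
      levelwiseMap, ← NatTrans.comp_app, ← NatTrans.comp_app, ← Functor.map_comp,
      ← Functor.map_comp, onQuo_proj]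
  comm_j p q x := ConcreteCategory.congr_hom
    (HomologicalComplex.HomologySequence.δ_naturality (φ.onShortComplex X p)
      (T.shortComplex_shortExact X p) (T'.shortComplex_shortExact X p) (q + 1) q rfl) x
  comm_k p q x := by
    refine ConcreteCategory.congr_hom (?_ : homotopyMap _ q ≫ homotopyMap _ q =
      homotopyMap _ q ≫ homotopyMap _ q) x
    rw [← HomologicalComplex.homologyMap_comp, ← HomologicalComplex.homologyMap_comp,
      ← Functor.map_comp, ← Functor.map_comp, levelwiseMap, levelwiseMap, levelwiseMap,
      levelwiseMap, ← NatTrans.comp_app, ← NatTrans.comp_app, ← Functor.map_comp,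
      ← Functor.map_comp, onGr_incl]

end Hom

end FilteredFunctor

/-! ### Lie rings: lower central series and dimension series -/

section LieRings

attribute [local instance] LieRing.ofAssociativeRing

variable (L : Type u) [LieRing L]

/-- The lower central series, indexed so that `γ_1(L) = L` and `γ_{n+1}(L) = [L, γ_n(L)]` for
`n ≥ 1` (and `γ_0(L) = L`). -/
def gamma (n : ℕ) : AddSubgroup L :=
  (LieModule.lowerCentralSeries ℤ L L (n - 1)).toSubmodule.toAddSubgroup

/-- The universal enveloping ring `U(L)` over `ℤ`. -/
abbrev U : Type u := UniversalEnvelopingAlgebra ℤ L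

/-- The natural map `ι : L → U(L)`, as a homomorphism of abelian groups. -/
def iota : L →+ U L := (UniversalEnvelopingAlgebra.ι ℤ (L := L)).toLinearMap.toAddMonoidHom

/-- The augmentation ideal of `U(L)`: the two-sided ideal generated by `ι(L)`. -/
def augIdeal : Ideal (U L) := (TwoSidedIdeal.span (Set.range (iota L))).asIdeal

/-- The power `ϖ^n(L)` of the augmentation ideal, as an additive subgroup; `ϖ^0(L) = U(L)`. -/
def augPower (n : ℕ) : AddSubgroup (U L) := (augIdeal L ^ n).toAddSubgroup

/-- The dimension series `δ_n(L) = L ∩ ϖ^n(L)`. -/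
def delta (n : ℕ) : AddSubgroup L := (augPower L n).comap (iota L)

lemma gamma_antitone : Antitone (gamma L) := fun _ _ h ↦
  LieModule.antitone_lowerCentralSeries ℤ L L (Nat.sub_le_sub_right h 1)

lemma augPower_antitone : Antitone (augPower L) := fun _ _ h ↦ Ideal.pow_le_pow_right h

lemma iota_lie (x y : L) : iota L ⁅x, y⁆ = iota L x * iota L y - iota L y * iota L x := by
  exact (UniversalEnvelopingAlgebra.ι ℤ (L := L)).map_lie x y

lemma iota_mem_augIdeal (x : L) : iota L x ∈ augIdeal L :=
  TwoSidedIdeal.subset_span ⟨x, rfl⟩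

lemma lcs_le_delta (n : ℕ) :
    (LieModule.lowerCentralSeries ℤ L L n).toSubmodule.toAddSubgroup ≤ delta L (n + 1) := by
  induction n with
  | zero =>
    intro x _
    change iota L x ∈ augIdeal L ^ (0 + 1)
    rw [zero_add, Submodule.pow_one]
    exact iota_mem_augIdeal L x
  | succ n ih =>
    intro x hx
    rw [LieModule.lowerCentralSeries_succ] at hx
    change x ∈ (⁅(⊤ : LieIdeal ℤ L), LieModule.lowerCentralSeries ℤ L L n⁆ :
      LieSubmodule ℤ L L).toSubmodule at hx
    rw [LieSubmodule.lieIdeal_oper_eq_linear_span'] at hx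
    refine Submodule.span_induction (p := fun x _ ↦ x ∈ delta L (n + 1 + 1)) ?_ ?_ ?_ ?_ hx
    · rintro _ ⟨a, -, b, hb, rfl⟩
      change iota L ⁅a, b⁆ ∈ augIdeal L ^ (n + 1 + 1)
      have ha := iota_mem_augIdeal L a
      have hb2 : iota L b ∈ augIdeal L ^ (n + 1) := ih hb
      rw [iota_lie]
      refine Ideal.sub_mem _ ?_ ?_
      · rw [Submodule.pow_succ' _ n.succ_ne_zero]
        exact Ideal.mul_mem_mul ha hb2
      · rw [Submodule.pow_succ]
        exact Ideal.mul_mem_mul hb2 ha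
    · exact AddSubgroup.zero_mem _
    · exact fun _ _ _ _ h h' ↦ AddSubgroup.add_mem _ h h'
    · exact fun a _ _ h ↦ AddSubgroup.zsmul_mem _ h a

lemma gamma_le_delta (n : ℕ) : gamma L n ≤ delta L n := by
  cases n with
  | zero =>
    intro x _
    change iota L x ∈ augIdeal L ^ 0
    rw [Submodule.pow_zero, Ideal.one_eq_top]
    trivial
  | succ n => exact lcs_le_delta L n

variable {L} {L' : Type u} [LieRing L']

lemma gamma_map_le (f : L →ₗ⁅ℤ⁆ L') (n : ℕ) :
    gamma L n ≤ (gamma L' n).comap f.toLinearMap.toAddMonoidHom := fun _ hx ↦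
  LieIdeal.map_lowerCentralSeries_le (n - 1) (LieIdeal.mem_map hx)

/-- The ring homomorphism `U(L) → U(L')` induced by a homomorphism of Lie rings. -/
def mapU (f : L →ₗ⁅ℤ⁆ L') : U L →ₐ[ℤ] U L' :=
  UniversalEnvelopingAlgebra.lift ℤ ((UniversalEnvelopingAlgebra.ι ℤ).comp f)

lemma mapU_iota (f : L →ₗ⁅ℤ⁆ L') (x : L) : mapU f (iota L x) = iota L' (f x) :=
  UniversalEnvelopingAlgebra.lift_ι_apply ℤ _ _

lemma mapU_id : mapU (LieHom.id : L →ₗ⁅ℤ⁆ L) = AlgHom.id ℤ _ := by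
  apply UniversalEnvelopingAlgebra.hom_ext
  ext x
  exact mapU_iota _ x

lemma mapU_comp {L'' : Type u} [LieRing L''] (g : L' →ₗ⁅ℤ⁆ L'') (f : L →ₗ⁅ℤ⁆ L') :
    mapU (g.comp f) = (mapU g).comp (mapU f) := by
  apply UniversalEnvelopingAlgebra.hom_ext
  ext x
  refine (mapU_iota _ x).trans ?_
  exact (((congrArg (mapU g) (mapU_iota f x))).trans (mapU_iota g _)).symm

lemma augIdeal_map_le (f : L →ₗ⁅ℤ⁆ L') : augIdeal L ≤ (augIdeal L').comap (mapU f) := by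
  have h : TwoSidedIdeal.span (Set.range (iota L)) ≤
      (TwoSidedIdeal.span (Set.range (iota L'))).comap (mapU f) := by
    rw [TwoSidedIdeal.span_le]
    rintro _ ⟨x, rfl⟩
    rw [SetLike.mem_coe, TwoSidedIdeal.mem_comap, mapU_iota]
    exact iota_mem_augIdeal L' _
  intro x hx
  rw [Ideal.mem_comap]
  exact TwoSidedIdeal.mem_asIdeal.2 ((TwoSidedIdeal.mem_comap _).1 (h (TwoSidedIdeal.mem_asIdeal.1 hx)))

lemma augPower_map_le (f : L →ₗ⁅ℤ⁆ L') (n : ℕ) :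
    augPower L n ≤ (augPower L' n).comap (mapU f).toRingHom.toAddMonoidHom := by
  suffices h : augIdeal L ^ n ≤ (augIdeal L' ^ n).comap (mapU f) from h
  induction n with
  | zero =>
    intro x _
    rw [Ideal.mem_comap, Submodule.pow_zero, Ideal.one_eq_top]
    trivial
  | succ n ih =>
    rw [Submodule.pow_succ, Submodule.pow_succ, Ideal.mul_le]
    intro a ha b hb
    rw [Ideal.mem_comap, map_mul]
    exact Ideal.mul_mem_mul (ih ha) (augIdeal_map_le f hb)

end LieRings

/-! ### The category of Lie rings and the two filtered functors -/

/-- The category of Lie rings. -/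
structure LieRingCat : Type (u + 1) where
  carrier : Type u
  [lieRing : LieRing carrier]

namespace LieRingCat

instance : CoeSort LieRingCat.{u} (Type u) := ⟨carrier⟩

attribute [instance] lieRing

instance : Category LieRingCat.{u} where
  Hom L L' := L →ₗ⁅ℤ⁆ L'
  id _ := LieHom.id
  comp f g := g.comp f

instance : ConcreteCategory LieRingCat.{u} (fun L L' ↦ L →ₗ⁅ℤ⁆ L') where
  hom f := f
  ofHom f := f

end LieRingCat

/-- The identity functor `L ↦ L` with the filtration by the lower central series (continued by
`γ_p(L) = L` for `p ≤ 0`). -/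
def lowerCentral : FilteredFunctor.{u} LieRingCat.{u} where
  G :=
    { obj := fun L ↦ AddCommGrpCat.of L
      map := fun f ↦ AddCommGrpCat.ofHom
        (ConcreteCategory.hom f : _ →ₗ⁅ℤ⁆ _).toLinearMap.toAddMonoidHom }
  F p L := gamma L p.toNat
  anti L _ _ h := gamma_antitone L (Int.toNat_le_toNat h)
  map_le p _ _ f := gamma_map_le f p.toNat

/-- The functor `L ↦ U(L)` with the filtration by the powers of the augmentation ideal (continued
by `ϖ^p(L) = U(L)` for `p ≤ 0`). -/
def augmentationPowers : FilteredFunctor.{u} LieRingCat.{u} where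
  G :=
    { obj := fun L ↦ AddCommGrpCat.of (U L)
      map := fun f ↦ AddCommGrpCat.ofHom
        (mapU (ConcreteCategory.hom f)).toRingHom.toAddMonoidHom
      map_id := fun L ↦ by
        ext x
        exact congrArg (fun g : U L →ₐ[ℤ] U L ↦ g x) mapU_id
      map_comp := fun {L L' L''} f g ↦ by
        ext x
        exact congrArg (fun h : U L →ₐ[ℤ] U L'' ↦ h x) (mapU_comp g f) }
  F p L := augPower L p.toNat
  anti L _ _ h := augPower_antitone L (Int.toNat_le_toNat h)
  map_le p _ _ f := augPower_map_le f p.toNat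

/-- The natural map `ι : L → U(L)`, which carries `γ_p(L)` into `ϖ^p(L)`. -/
def iotaFiltered : FilteredFunctor.Hom lowerCentral.{u} augmentationPowers.{u} where
  τ :=
    { app := fun L ↦ AddCommGrpCat.ofHom (iota L)
      naturality := fun L L' f ↦ by
        ext x
        exact (mapU_iota f x).symm }
  map_le p L := gamma_le_delta L p.toNat

/-! ### Free simplicial resolutions -/

/-- A simplicial Lie ring augmented over the Lie ring `L`. -/
structure AugmentedSimplicialLieRing (L : Type u) [LieRing L] where
  X : SimplicialObject LieRingCat.{u}
  aug : X _⦋0⦌ →ₗ⁅ℤ⁆ L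
  aug_face : ∀ x : X _⦋1⦌, aug (X.δ 0 x) = aug (X.δ 1 x)

namespace AugmentedSimplicialLieRing

variable {L : Type u} [LieRing L] (R : AugmentedSimplicialLieRing L)

/-- `R` is aspherical: for every `n ≥ -1`, every family `(a_0, …, a_{n+1})` of elements of `X_n`
(where `X_{-1} = L`) such that `d_i a_j = d_{j-1} a_i` for all `i < j` is of the form
`(d_0 x, …, d_{n+1} x)` for some `x` in `X_{n+1}`. The three conditions are the cases `n = -1`,
`n = 0` and `n ≥ 1`; in the last one `(i, j)` is written as `(i, j + 1)` with `i ≤ j`. -/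
structure IsAspherical : Prop where
  surjective_aug : Function.Surjective R.aug
  exists_one : ∀ a₀ a₁ : R.X _⦋0⦌, R.aug a₁ = R.aug a₀ →
    ∃ x : R.X _⦋1⦌, R.X.δ 0 x = a₀ ∧ R.X.δ 1 x = a₁
  exists_succ : ∀ (n : ℕ) (a : Fin (n + 1 + 2) → R.X _⦋n + 1⦌),
    (∀ i j : Fin (n + 2), i ≤ j → R.X.δ i (a j.succ) = R.X.δ j (a i.castSucc)) →
      ∃ x : R.X _⦋n + 1 + 1⦌, ∀ i : Fin (n + 1 + 2), R.X.δ i x = a i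

/-- `R` is free: there are sets `S_n ⊆ X_n` of free generators of the Lie rings `X_n`, `n ≥ 0`,
that are preserved by the degeneracy maps. -/
def IsFree : Prop :=
  ∃ S : ∀ n : ℕ, Set (R.X _⦋n⦌),
    (∀ n : ℕ, Function.Bijective
      (FreeLieAlgebra.lift ℤ (Subtype.val : S n → R.X _⦋n⦌))) ∧
    ∀ (n : ℕ) (i : Fin (n + 1)), ∀ x ∈ S n, R.X.σ i x ∈ S (n + 1)

/-- `R` is a free simplicial resolution of `L`. -/
structure IsFreeResolution : Prop where
  isAspherical : R.IsAspherical
  isFree : R.IsFree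

/-- The exact couple of the lower central series of the simplicial Lie ring `X`; its spectral
sequence is `E^r_{p,q}`, with `E^1_{p,q} = π_q(γ_p(X) / γ_{p+1}(X))`. -/
abbrev lowerCentralCouple : ExactCouple.{u} := lowerCentral.exactCouple R.X

/-- The exact couple of the augmentation powers of the simplicial ring `U(X)`; its spectral
sequence is `Ē^r_{p,q}`, with `Ē^1_{p,q} = π_q(ϖ^p(X) / ϖ^{p+1}(X))`. -/
abbrev augmentationCouple : ExactCouple.{u} := augmentationPowers.exactCouple R.X

/-- The map `ι^∞_{p,q} : E^∞_{p,q} → Ē^∞_{p,q}`. -/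
def iotaInfty (p : ℤ) (q : ℕ) :
    R.lowerCentralCouple.EInfty p q →+ R.augmentationCouple.EInfty p q :=
  (iotaFiltered.onExactCouple R.X).onEInfty p q

/-- The composite `γ_n(X_0) → γ_n(X_0) / γ_{n+1}(X_0) → π_0(γ_n(X) / γ_{n+1}(X)) = E^1_{n,0} →
E^∞_{n,0}`. -/
def limitClass (n : ℕ) : gamma (R.X _⦋0⦌) n →+ R.lowerCentralCouple.EInfty n 0 :=
  (R.lowerCentralCouple.edge n).comp
    ((toHomotopyZero (levelwise R.X (lowerCentral.gr n))).hom.comp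
      (SubQuotient.mk (gamma (R.X _⦋0⦌) n) (gamma (R.X _⦋0⦌) (n + 1))))

/-- The map `γ_n(X_0) → γ_n(L) / γ_{n+1}(L)` induced by the augmentation. -/
def augClass (n : ℕ) : gamma (R.X _⦋0⦌) n →+ SubQuotient (gamma L n) (gamma L (n + 1)) :=
  (SubQuotient.map R.aug.toLinearMap.toAddMonoidHom (gamma_map_le R.aug n)
    (gamma_map_le R.aug (n + 1))).comp (SubQuotient.mk _ _)

end AugmentedSimplicialLieRing

end LieDimension

end

noncomputable section

namespace LieDimension

/-! ### The row `q = 0` of an exact couple -/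

namespace ExactCouple

variable (C : ExactCouple.{u})

/-! On the row `q = 0` every element is a cycle. For both filtrations `F_0` is everything, so the
towers start from zero and `B^∞_{n,0}` is all of `im j = ker k`. Hence `E^∞_{n,0}` is the image of
`π_0(F_n / F_{n+1})` in `π_0(G / F_{n+1})`.

Asphericity presents `L` as the coequalizer of the two faces `X_1 → X_0`, which have the common
section `s_0`. Since `γ_{n+1}(X_0) → γ_{n+1}(L)` is onto, `π_0(X / γ_{n+1}(X)) = L / γ_{n+1}(L)`.
The functor `U` preserves reflexive coequalizers (`exists_mapU_sub_eq`) and `ϖ^{n+1}(X_0) →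
ϖ^{n+1}(L)` is onto (`exists_mem_augPower`), so likewise `π_0(U(X) / ϖ^{n+1}(X)) = U(L) /
ϖ^{n+1}(L)`.

The two limit terms are therefore `γ_n(L) / γ_{n+1}(L)` and `ϖ^n(L) / ϖ^{n+1}(L)`, and `ι^∞` is
induced by `ι`. A class dies exactly when its representative `x` satisfies `ι x ∈ ϖ^{n+1}(L)`, that
is, `x ∈ δ_{n+1}(L)`. -/

lemma edge_surjective (p : ℤ) : Function.Surjective (C.edge p) := by
  intro y
  obtain ⟨x, rfl⟩ := SubQuotient.mk_surjective _ _ y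
  exact ⟨x, rfl⟩

lemma boundariesInfty_le_ker_k (p : ℤ) (q : ℕ) : C.boundariesInfty p q ≤ (C.k p q).ker := by
  refine iSup_le fun s ↦ ?_
  rintro _ ⟨w, -, rfl⟩
  exact (C.exact_jk p q).apply_apply_eq_zero w

/-- If `D_{p', q + 1}` vanishes for some `p' ≤ p`, then `B^∞_{p,q}` is the whole kernel of `k`. -/
lemma boundariesInfty_eq_ker_k {p : ℤ} {q s : ℕ} (h : Subsingleton (C.D (p - s) (q + 1))) :
    C.boundariesInfty p q = (C.k p q).ker := by
  refine le_antisymm (C.boundariesInfty_le_ker_k p q) fun x hx ↦ ?_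
  obtain ⟨w, rfl⟩ := (C.exact_jk p q x).1 hx
  -- The target of `i^s` is zero, so every `w` lies in its kernel and `j w` is already a boundary at
  -- stage `s`.
  exact le_iSup (fun s ↦ C.boundaries s p q) s ⟨w, Subsingleton.elim _ _, rfl⟩

/-- With no cycle condition and `B^∞ = ker k`, the term `E^∞_{p,0}` is `E^1_{p,0} / ker k`, a copy
of the image of `k` in `D_{p+1,0}`. -/
lemma edge_eq_zero_iff {p : ℤ} {s : ℕ} (h : Subsingleton (C.D (p - s) 1)) (x : C.E p 0) :
    C.edge p x = 0 ↔ C.k p 0 x = 0 := by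
  refine (SubQuotient.mk_eq_zero_iff _).trans ?_
  rw [C.boundariesInfty_eq_ker_k h]
  rfl

lemma Hom.onEInfty_edge {C C' : ExactCouple.{u}} (φ : Hom C C') (p : ℤ) (x : C.E p 0) :
    φ.onEInfty p 0 (C.edge p x) = C'.edge p (φ.onE p 0 x) :=
  rfl

end ExactCouple

/-! ### The group `π_0` -/

section HomotopyZero

variable {X Y : SimplicialObject AddCommGrpCat.{u}}

lemma toHomotopyZero_surjective (X : SimplicialObject AddCommGrpCat.{u}) :
    Function.Surjective (toHomotopyZero X) :=
  (AddCommGrpCat.epi_iff_surjective _).1 (epi_comp _ _)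

lemma toHomotopyZero_naturality (f : X ⟶ Y) :
    toHomotopyZero X ≫ homotopyMap f 0 = f.app (op ⦋0⦌) ≫ toHomotopyZero Y := by
  rw [toHomotopyZero, toHomotopyZero, Category.assoc,
    ← cancel_mono (ChainComplex.isoHomologyι₀ _).hom]
  simp

lemma homotopyMap_toHomotopyZero (f : X ⟶ Y) (x : X _⦋0⦌) :
    homotopyMap f 0 (toHomotopyZero X x) = toHomotopyZero Y (f.app (op ⦋0⦌) x) :=
  ConcreteCategory.congr_hom (toHomotopyZero_naturality f) x

/-- `π_0` is the cokernel of the degree-one differential of the alternating face map complex, which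
is `d_0 - d_1`. -/
lemma toHomotopyZero_eq_zero_iff (x : X _⦋0⦌) :
    toHomotopyZero X x = 0 ↔ ∃ w : X _⦋1⦌, X.δ 0 w - X.δ 1 w = x := by
  let K := (AlgebraicTopology.alternatingFaceMapComplex AddCommGrpCat.{u}).obj X
  have hd (w : X _⦋1⦌) : K.d 1 0 w = X.δ 0 w - X.δ 1 w := by
    simp [K, AlgebraicTopology.AlternatingFaceMapComplex.objD, Fin.sum_univ_two, sub_eq_add_neg]
  have hex := (ShortComplex.ab_exact_iff_function_exact _).1
    ((ShortComplex.mk _ _ (K.d_pOpcycles 1 0)).exact_of_g_is_cokernel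
      (K.opcyclesIsCokernel 1 0 (by simp)))
  have hinj := (AddCommGrpCat.mono_iff_injective (ChainComplex.isoHomologyι₀ K).inv).1 inferInstance
  refine (map_eq_zero_iff (ChainComplex.isoHomologyι₀ K).inv.hom hinj).trans ?_
  refine (hex x).trans (exists_congr fun w ↦ ?_)
  rw [← hd]

end HomotopyZero

/-! ### The limit terms on the row `q = 0` -/

namespace FilteredFunctor

variable {A : Type v} [Category.{w} A] (T : FilteredFunctor.{u} A) (X : SimplicialObject A)

/-- The composite `F_p X_0 → F_p X_0 / F_{p+1} X_0 → E^1_{p,0} → E^∞_{p,0}`. -/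
def limitClass (p : ℤ) : T.F p (X _⦋0⦌) →+ (T.exactCouple X).EInfty p 0 :=
  ((T.exactCouple X).edge p).comp ((toHomotopyZero (levelwise X (T.gr p))).hom.comp
    (SubQuotient.mk (T.F p (X _⦋0⦌)) (T.F (p + 1) (X _⦋0⦌))))

lemma limitClass_surjective (p : ℤ) : Function.Surjective (T.limitClass X p) :=
  ((T.exactCouple X).edge_surjective p).comp
    ((toHomotopyZero_surjective _).comp (SubQuotient.mk_surjective _ _))

variable {T X}

/-- Applied where the filtration is still everything, this supplies the vanishing term at the bottom
of the tower; the complex of `G / F_p` is zero in each degree. -/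
lemma subsingleton_exactCouple_D {p : ℤ} (h : ∀ Y : A, T.F p Y = ⊤) (q : ℕ) :
    Subsingleton ((T.exactCouple X).D p q) := by
  refine AddCommGrpCat.subsingleton_of_isZero (ShortComplex.isZero_homology_of_isZero_X₂ _ ?_)
  have : Subsingleton (T.G.obj (X _⦋q⦌) ⧸ T.F p (X _⦋q⦌)) := by
    rw [h]
    exact QuotientAddGroup.subsingleton_quotient_top
  exact AddCommGrpCat.isZero_of_subsingleton (AddCommGrpCat.of (T.G.obj (X _⦋q⦌) ⧸ T.F p (X _⦋q⦌)))

/-- The kernel of `F_p X_0 → E^∞_{p,0}` consists of the elements which vanish in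
`π_0(G X / F_{p+1} X)`. -/
lemma limitClass_eq_zero_iff {p : ℤ} {s : ℕ} (h : ∀ Y : A, T.F (p - s) Y = ⊤)
    (x : T.F p (X _⦋0⦌)) :
    T.limitClass X p x = 0 ↔ ∃ w : T.G.obj (X _⦋1⦌),
      (T.G.map (X.δ 0)).hom w - (T.G.map (X.δ 1)).hom w - x ∈ T.F (p + 1) (X _⦋0⦌) := by
  refine (ExactCouple.edge_eq_zero_iff _ (subsingleton_exactCouple_D h 1) _).trans ?_
  -- The map `k` is induced by `F_p / F_{p+1} → G / F_{p+1}`, so it forgets only that `x` lies in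
  -- `F_p`.
  have e : (T.exactCouple X).k p 0 (toHomotopyZero (levelwise X (T.gr p)) (SubQuotient.mk _ _ x)) =
      toHomotopyZero (levelwise X (T.quo (p + 1))) (QuotientAddGroup.mk (x : T.G.obj (X _⦋0⦌))) :=
    homotopyMap_toHomotopyZero (levelwiseMap X (T.incl p)) _
  refine (Eq.congr_left e).trans ((toHomotopyZero_eq_zero_iff _).trans ?_)
  constructor
  · rintro ⟨w, hw⟩
    -- Lifting `w` to `G X_1` turns an equality in the quotient into a congruence modulo `F_{p+1}
    -- X_0`.
    obtain ⟨w, rfl⟩ := QuotientAddGroup.mk_surjective w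
    refine ⟨w, (QuotientAddGroup.eq_zero_iff _).1 ?_⟩
    rw [QuotientAddGroup.mk_sub, sub_eq_zero]
    exact hw
  · rintro ⟨w, hw⟩
    refine ⟨QuotientAddGroup.mk w, ?_⟩
    rw [← QuotientAddGroup.eq_zero_iff, QuotientAddGroup.mk_sub, sub_eq_zero] at hw
    exact hw

lemma Hom.onEInfty_limitClass {T' : FilteredFunctor.{u} A} (φ : Hom T T') (p : ℤ)
    (x : T.F p (X _⦋0⦌)) :
    (φ.onExactCouple X).onEInfty p 0 (T.limitClass X p x) =
      T'.limitClass X p ⟨(φ.τ.app _).hom x, φ.map_le p _ x.2⟩ :=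
  congrArg ((T'.exactCouple X).edge p) (homotopyMap_toHomotopyZero (levelwiseMap X (φ.onGr p)) _)

end FilteredFunctor

/-! ### Surjections of Lie rings and reflexive coequalizers -/

section Surjections

attribute [local instance] LieRing.ofAssociativeRing

variable {L L' : Type u} [LieRing L] [LieRing L'] {f : L →ₗ⁅ℤ⁆ L'}

/-- Used in two ways: to represent classes of `γ_n(L)` by elements of `γ_n(X_0)`, and to absorb an
error lying in `γ_{n+1}(L)`. -/
lemma exists_mem_gamma (hf : Function.Surjective f) {n : ℕ} {y : L'} (hy : y ∈ gamma L' n) :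
    ∃ x ∈ gamma L n, f x = y := by
  obtain ⟨x, hx⟩ := LieIdeal.mem_map_of_surjective (I := LieModule.lowerCentralSeries ℤ L L (n - 1))
    hf ((LieIdeal.lowerCentralSeries_map_eq (n - 1) hf).ge hy)
  exact ⟨x, x.2, hx⟩

/-- The range is a subalgebra containing `ι(L')`. The universal property maps `U(L')` into it, and
composing with the inclusion gives the identity, so the range is everything. -/
lemma mapU_surjective (hf : Function.Surjective f) : Function.Surjective (mapU f) := by
  have h : ∀ y : L', iota L' y ∈ (mapU f).range := fun y ↦ by
    obtain ⟨x, rfl⟩ := hf y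
    exact ⟨iota L x, mapU_iota f x⟩
  let g : L' →ₗ⁅ℤ⁆ (mapU f).range :=
    { toFun := fun y ↦ ⟨iota L' y, h y⟩
      map_add' := fun x y ↦ Subtype.ext (map_add (iota L') x y)
      map_smul' := fun c x ↦ Subtype.ext (map_zsmul (iota L') c x)
      map_lie' := fun {x y} ↦ Subtype.ext (iota_lie L' x y) }
  have e : (mapU f).range.val.comp (UniversalEnvelopingAlgebra.lift ℤ g) = AlgHom.id ℤ (U L') := by
    apply UniversalEnvelopingAlgebra.hom_ext
    ext x
    exact congrArg Subtype.val (UniversalEnvelopingAlgebra.lift_ι_apply ℤ g x)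
  intro y
  obtain ⟨x, hx⟩ := (UniversalEnvelopingAlgebra.lift ℤ g y).2
  exact ⟨x, hx.trans (DFunLike.congr_fun e y)⟩

/-- The liftable elements form a two-sided ideal containing the generators; closure under
multiplication needs the arbitrary factor `c` to be lifted, by `mapU_surjective`. -/
lemma exists_mem_augIdeal (hf : Function.Surjective f) {y : U L'} (hy : y ∈ augIdeal L') :
    ∃ x ∈ augIdeal L, mapU f x = y := by
  refine TwoSidedIdeal.span_induction (p := fun y _ ↦ ∃ x ∈ augIdeal L, mapU f x = y)
    ?_ ?_ ?_ ?_ ?_ ?_ (TwoSidedIdeal.mem_asIdeal.1 hy)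
  · rintro _ ⟨y, rfl⟩
    obtain ⟨x, rfl⟩ := hf y
    exact ⟨iota L x, iota_mem_augIdeal L x, mapU_iota f x⟩
  · exact ⟨0, zero_mem _, map_zero _⟩
  · rintro _ _ _ _ ⟨a, ha, rfl⟩ ⟨b, hb, rfl⟩
    exact ⟨a + b, add_mem ha hb, map_add _ a b⟩
  · rintro _ _ ⟨a, ha, rfl⟩
    exact ⟨-a, neg_mem ha, map_neg _ a⟩
  · rintro c _ _ ⟨a, ha, rfl⟩
    obtain ⟨c, rfl⟩ := mapU_surjective hf c
    exact ⟨c * a, Ideal.mul_mem_left _ c ha, map_mul _ c a⟩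
  · rintro c _ _ ⟨a, ha, rfl⟩
    obtain ⟨c, rfl⟩ := mapU_surjective hf c
    exact ⟨a * c, (TwoSidedIdeal.span _).mul_mem_right a c ha, map_mul _ a c⟩

lemma exists_mem_augPower (hf : Function.Surjective f) {n : ℕ} {y : U L'}
    (hy : y ∈ augPower L' n) : ∃ x ∈ augPower L n, mapU f x = y := by
  suffices h : ∀ y ∈ augIdeal L' ^ n, ∃ x ∈ augIdeal L ^ n, mapU f x = y from h y hy
  clear hy y
  induction n with
  | zero =>
    intro y _
    obtain ⟨x, rfl⟩ := mapU_surjective hf y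
    exact ⟨x, by rw [Submodule.pow_zero, Ideal.one_eq_top]; trivial, rfl⟩
  | succ n ih =>
    intro y hy
    rw [Submodule.pow_succ] at hy ⊢
    induction hy using Submodule.mul_induction_on' with
    | mem_mul_mem a ha b hb =>
      obtain ⟨a, ha', rfl⟩ := ih a ha
      obtain ⟨b, hb', rfl⟩ := exists_mem_augIdeal hf hb
      exact ⟨a * b, Ideal.mul_mem_mul ha' hb', map_mul _ a b⟩
    | add a _ b _ ha hb =>
      obtain ⟨a, ha, rfl⟩ := ha
      obtain ⟨b, hb, rfl⟩ := hb
      exact ⟨a + b, Ideal.add_mem _ ha hb, map_add _ a b⟩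

/-- The functor `U` preserves reflexive coequalizers. -/
lemma exists_mapU_sub_eq {L₁ : Type u} [LieRing L₁] {d₀ d₁ : L₁ →ₗ⁅ℤ⁆ L} {s : L →ₗ⁅ℤ⁆ L₁}
    (hs₀ : d₀.comp s = LieHom.id) (hs₁ : d₁.comp s = LieHom.id) (hf : Function.Surjective f)
    (h : ∀ x, f x = 0 → ∃ w, d₀ w - d₁ w = x) {x : U L} (hx : mapU f x = 0) :
    ∃ w, mapU d₀ w - mapU d₁ w = x := by
  have hs₀' : ∀ x, mapU d₀ (mapU s x) = x := fun x ↦ by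
    rw [← AlgHom.comp_apply, ← mapU_comp, hs₀, mapU_id, AlgHom.id_apply]
  have hs₁' : ∀ x, mapU d₁ (mapU s x) = x := fun x ↦ by
    rw [← AlgHom.comp_apply, ← mapU_comp, hs₁, mapU_id, AlgHom.id_apply]
  -- The differences form a left ideal because of the common section: `c * (d₀ a - d₁ a) = d₀ (s c *
  -- a) - d₁ (s c * a)`. The right-hand version is symmetric.
  let I : Ideal (U L) :=
    { carrier := {x | ∃ w, mapU d₀ w - mapU d₁ w = x}
      zero_mem' := ⟨0, by simp⟩
      add_mem' := by
        rintro _ _ ⟨a, rfl⟩ ⟨b, rfl⟩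
        exact ⟨a + b, by simp only [map_add]; abel⟩
      smul_mem' := by
        rintro c _ ⟨a, rfl⟩
        exact ⟨mapU s c * a, by simp only [map_mul, hs₀', hs₁', smul_eq_mul, mul_sub]⟩ }
  have : I.IsTwoSided := ⟨by
    rintro _ c ⟨a, rfl⟩
    exact ⟨a * mapU s c, by simp only [map_mul, hs₀', hs₁', sub_mul]⟩⟩
  let π : U L →ₐ[ℤ] U L ⧸ I := Ideal.Quotient.mkₐ ℤ I
  -- Modulo `I` the map `ι` depends only on `f x`, since elements of `ker f` are differences of
  -- faces.
  have hπ : ∀ {x y : L}, f x = f y → π (iota L x) = π (iota L y) := fun {x y} hxy ↦ by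
    refine Ideal.Quotient.eq.2 ?_
    obtain ⟨w, hw⟩ := h (x - y) (by rw [map_sub, hxy, sub_self])
    exact ⟨iota L₁ w, by rw [mapU_iota, mapU_iota, ← map_sub, ← map_sub, hw]⟩
  -- `σ` is only a set-theoretic section; `hπ` makes the induced map `g` additive and compatible
  -- with brackets.
  choose σ hσ using hf
  let g : L' →ₗ⁅ℤ⁆ U L ⧸ I :=
    { toFun := fun y ↦ π (iota L (σ y))
      map_add' := fun x y ↦ by
        rw [← map_add, ← map_add]
        exact hπ (by simp only [map_add, hσ])
      map_smul' := fun c x ↦ by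
        rw [RingHom.id_apply, ← map_zsmul, ← map_zsmul]
        exact hπ (by simp only [map_zsmul, hσ])
      map_lie' := fun {x y} ↦ by
        rw [LieRing.of_associative_ring_bracket, ← map_mul π, ← map_mul π, ← map_sub π, ← iota_lie]
        exact hπ (by simp only [LieHom.map_lie, hσ]) }
  -- The quotient map `π` factors through `mapU f`, which forces `ker (mapU f)` into `I`.
  have e : (UniversalEnvelopingAlgebra.lift ℤ g).comp (mapU f) = π := by
    apply UniversalEnvelopingAlgebra.hom_ext
    ext x
    refine (congrArg (UniversalEnvelopingAlgebra.lift ℤ g) (mapU_iota f x)).trans ?_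
    exact (UniversalEnvelopingAlgebra.lift_ι_apply ℤ g (f x)).trans (hπ (hσ _))
  have hxI : π x = 0 := by
    rw [← e, AlgHom.comp_apply, hx, map_zero]
  exact Ideal.Quotient.eq_zero_iff_mem.1 hxI

end Surjections

/-! ### The limit terms of the two spectral sequences -/

lemma gamma_zero (L : Type u) [LieRing L] : gamma L 0 = ⊤ := by
  ext
  simp [gamma]

lemma augPower_zero (L : Type u) [LieRing L] : augPower L 0 = ⊤ := by
  rw [augPower, Submodule.pow_zero, Ideal.one_eq_top]
  rfl

lemma iota_mem_augPower {L : Type u} [LieRing L] {n : ℕ} {x : L} (hx : x ∈ gamma L n) :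
    iota L x ∈ augPower L n := by
  have h : x ∈ delta L n := gamma_le_delta L n hx
  exact h

namespace AugmentedSimplicialLieRing

variable {L : Type u} [LieRing L] {R : AugmentedSimplicialLieRing L}

/-- The face `d_i : X_1 → X_0`. -/
abbrev face (R : AugmentedSimplicialLieRing L) (i : Fin 2) : R.X _⦋1⦌ →ₗ⁅ℤ⁆ R.X _⦋0⦌ :=
  ConcreteCategory.hom (R.X.δ i)

/-- The degeneracy `s_0 : X_0 → X_1`. -/
abbrev degeneracy (R : AugmentedSimplicialLieRing L) : R.X _⦋0⦌ →ₗ⁅ℤ⁆ R.X _⦋1⦌ :=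
  ConcreteCategory.hom (R.X.σ (0 : Fin 1))

lemma face_zero_comp_degeneracy : (R.face 0).comp R.degeneracy = LieHom.id :=
  R.X.δ_comp_σ_self (i := (0 : Fin 1))

lemma face_one_comp_degeneracy : (R.face 1).comp R.degeneracy = LieHom.id :=
  R.X.δ_comp_σ_succ (i := (0 : Fin 1))

lemma aug_comp_face : R.aug.comp (R.face 0) = R.aug.comp (R.face 1) :=
  LieHom.ext R.aug_face

/-- This is asphericity in degree zero for the pair `(x, 0)`, compatible because both entries map to
`0` in `L`. -/
lemma IsAspherical.exists_face_sub_eq (hR : R.IsAspherical) (x : R.X _⦋0⦌) (hx : R.aug x = 0) :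
    ∃ w, R.face 0 w - R.face 1 w = x := by
  obtain ⟨w, h₀, h₁⟩ := hR.exists_one x 0 (by rw [hx, map_zero])
  exact ⟨w, by rw [face, face, h₀, h₁, sub_zero]⟩

lemma IsAspherical.augClass_surjective (hR : R.IsAspherical) (n : ℕ) :
    Function.Surjective (R.augClass n) := by
  intro y
  obtain ⟨⟨y, hy⟩, rfl⟩ := SubQuotient.mk_surjective _ _ y
  obtain ⟨x, hx, rfl⟩ := exists_mem_gamma hR.surjective_aug hy
  exact ⟨⟨x, hx⟩, rfl⟩

lemma augClass_eq_zero_iff {n : ℕ} (x : gamma (R.X _⦋0⦌) n) :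
    R.augClass n x = 0 ↔ R.aug x ∈ gamma L (n + 1) :=
  SubQuotient.mk_eq_zero_iff _

lemma limitClass_surjective (n : ℕ) : Function.Surjective (R.limitClass n) :=
  lowerCentral.limitClass_surjective R.X n

/-- `π_0(X / γ_{n+1}(X)) = L / γ_{n+1}(L)`. -/
lemma IsAspherical.limitClass_eq_zero_iff (hR : R.IsAspherical) {n : ℕ} (x : gamma (R.X _⦋0⦌) n) :
    R.limitClass n x = 0 ↔ R.aug x ∈ gamma L (n + 1) := by
  -- Taking `s = n` goes down to filtration index `n - n = 0`, where the subgroup is everything.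
  refine (FilteredFunctor.limitClass_eq_zero_iff (T := lowerCentral) (p := n) (s := n)
    (fun Y ↦ by rw [sub_self]; exact gamma_zero Y) x).trans ?_
  change (∃ w : R.X _⦋1⦌, R.face 0 w - R.face 1 w - x ∈ gamma (R.X _⦋0⦌) (n + 1)) ↔ _
  constructor
  · rintro ⟨w, hw⟩
    have : R.aug (R.face 0 w - R.face 1 w - x) ∈ gamma L (n + 1) := gamma_map_le R.aug _ hw
    rwa [map_sub, map_sub, ← LieHom.comp_apply, aug_comp_face, LieHom.comp_apply, sub_self,
      zero_sub, neg_mem_iff] at this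
  · intro hx
    obtain ⟨y, hy, hxy⟩ := exists_mem_gamma hR.surjective_aug hx
    -- Here `y ∈ γ_{n+1}(X_0)` has the same image in `L` as `x`, so `x - y` is a difference of faces
    -- and only `-y` remains as error.
    obtain ⟨w, hw⟩ := hR.exists_face_sub_eq (x - y) (by rw [map_sub, hxy, sub_self])
    refine ⟨w, ?_⟩
    rw [hw, sub_sub_cancel_left]
    exact neg_mem hy

/-- `π_0(U(X) / ϖ^{n+1}(X)) = U(L) / ϖ^{n+1}(L)`. -/
lemma IsAspherical.augmentationPowers_limitClass_eq_zero_iff (hR : R.IsAspherical) {n : ℕ}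
    (x : augPower (R.X _⦋0⦌) n) :
    augmentationPowers.limitClass R.X n x = 0 ↔ mapU R.aug x ∈ augPower L (n + 1) := by
  refine (FilteredFunctor.limitClass_eq_zero_iff (T := augmentationPowers) (p := n) (s := n)
    (fun Y ↦ by rw [sub_self]; exact augPower_zero Y) x).trans ?_
  change (∃ w : U (R.X _⦋1⦌),
    mapU (R.face 0) w - mapU (R.face 1) w - x ∈ augPower (R.X _⦋0⦌) (n + 1)) ↔ _
  constructor
  · rintro ⟨w, hw⟩
    have : mapU R.aug (mapU (R.face 0) w - mapU (R.face 1) w - x) ∈ augPower L (n + 1) :=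
      augPower_map_le R.aug _ hw
    rwa [map_sub, map_sub, ← AlgHom.comp_apply, ← mapU_comp, aug_comp_face, mapU_comp,
      AlgHom.comp_apply, sub_self, zero_sub, neg_mem_iff] at this
  · intro hx
    obtain ⟨y, hy, hxy⟩ := exists_mem_augPower hR.surjective_aug hx
    -- The kernel of `mapU R.aug` is again made of differences of faces, because `s_0` splits both
    -- faces.
    obtain ⟨w, hw⟩ := exists_mapU_sub_eq face_zero_comp_degeneracy face_one_comp_degeneracy
      hR.surjective_aug hR.exists_face_sub_eq (x := x - y) (by rw [map_sub, hxy, sub_self])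
    refine ⟨w, ?_⟩
    rw [hw, sub_sub_cancel_left]
    exact neg_mem hy

/-- `ι^∞` sends the class of `x` to the class of `ι x`, and `ι x` maps to `ι (R.aug x)` in `U(L)`;
membership of the latter in `ϖ^{n+1}(L)` defines `δ_{n+1}(L)`. -/
lemma IsAspherical.iotaInfty_limitClass_eq_zero_iff (hR : R.IsAspherical) {n : ℕ}
    (x : gamma (R.X _⦋0⦌) n) :
    R.iotaInfty n 0 (R.limitClass n x) = 0 ↔ R.aug x ∈ delta L (n + 1) := by
  let y : augPower (R.X _⦋0⦌) n := ⟨iota _ (x : R.X _⦋0⦌), iota_mem_augPower x.2⟩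
  have e : R.iotaInfty n 0 (R.limitClass n x) = augmentationPowers.limitClass R.X n y :=
    iotaFiltered.onEInfty_limitClass (X := R.X) (n : ℤ) x
  rw [e, hR.augmentationPowers_limitClass_eq_zero_iff y, mapU_iota]
  exact Iff.rfl

/-- Two surjections out of `γ_n(X_0)` with the same kernel have canonically isomorphic targets; this
produces `φ`. -/
lemma IsAspherical.ker_augClass (hR : R.IsAspherical) (n : ℕ) :
    (R.augClass n).ker = (R.limitClass n).ker := by
  ext x
  exact (augClass_eq_zero_iff x).trans (hR.limitClass_eq_zero_iff x).symm

/-- The isomorphism `γ_n(L) / γ_{n+1}(L) ≃ E^∞_{n,0}`. -/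
def IsAspherical.limitEquiv (hR : R.IsAspherical) (n : ℕ) :
    SubQuotient (gamma L n) (gamma L (n + 1)) ≃+ R.lowerCentralCouple.EInfty n 0 :=
  (QuotientAddGroup.quotientKerEquivOfSurjective _ (hR.augClass_surjective n)).symm.trans
    ((QuotientAddGroup.quotientAddEquivOfEq (hR.ker_augClass n)).trans
      (QuotientAddGroup.quotientKerEquivOfSurjective _ (limitClass_surjective n)))

lemma IsAspherical.limitEquiv_augClass (hR : R.IsAspherical) {n : ℕ} (x : gamma (R.X _⦋0⦌) n) :
    hR.limitEquiv n (R.augClass n x) = R.limitClass n x := by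
  have h : (QuotientAddGroup.quotientKerEquivOfSurjective _ (hR.augClass_surjective n)).symm
      (R.augClass n x) = QuotientAddGroup.mk x := by
    rw [AddEquiv.symm_apply_eq]
    rfl
  rw [limitEquiv, AddEquiv.trans_apply, h]
  rfl

end AugmentedSimplicialLieRing

end LieDimension

end

/-! ### The kernel of `ι^∞` on the row `q = 0` -/

theorem mainTheorem12 {L : Type u} [LieRing L] (R : LieDimension.AugmentedSimplicialLieRing L)
    (hR : R.IsFreeResolution) (n : ℕ) (hn : 1 ≤ n) :
    ∃ φ : LieDimension.SubQuotient (LieDimension.gamma L n) (LieDimension.gamma L (n + 1)) ≃+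
        R.lowerCentralCouple.EInfty n 0,
      (∀ x : LieDimension.gamma (R.X _⦋0⦌) n, φ (R.augClass n x) = R.limitClass n x) ∧
      (LieDimension.SubQuotient.sub (LieDimension.gamma L n ⊓ LieDimension.delta L (n + 1))
          (LieDimension.gamma L n) (LieDimension.gamma L (n + 1))).map φ.toAddMonoidHom =
        (R.iotaInfty n 0).ker := by
  have hA := hR.isAspherical
  refine ⟨hA.limitEquiv n, hA.limitEquiv_augClass, le_antisymm ?_ fun z hz ↦ ?_⟩
  · rintro _ ⟨_, ⟨⟨y, hy⟩, hyδ, rfl⟩, rfl⟩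
    -- A representative in `γ_n(X_0)` is needed because `φ` is only described on classes coming from
    -- there.
    obtain ⟨x, hx, rfl⟩ := LieDimension.exists_mem_gamma hA.surjective_aug hy
    refine AddMonoidHom.mem_ker.2 ((congrArg _ (hA.limitEquiv_augClass ⟨x, hx⟩)).trans ?_)
    exact (hA.iotaInfty_limitClass_eq_zero_iff ⟨x, hx⟩).2 hyδ.2
  · obtain ⟨x, rfl⟩ := LieDimension.AugmentedSimplicialLieRing.limitClass_surjective n z
    -- The preimage of `z` under `φ` is the class of `R.aug x`, for any `x` representing `z`.
    refine ⟨R.augClass n x, ⟨⟨R.aug x, LieDimension.gamma_map_le R.aug n x.2⟩, ⟨?_, ?_⟩, rfl⟩,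
      hA.limitEquiv_augClass x⟩
    · exact LieDimension.gamma_map_le R.aug n x.2
    · exact (hA.iotaInfty_limitClass_eq_zero_iff x).1 hz
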